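/- Let $\mathbb H$ be a separable real Hilbert space, $W=(W(h))_{h\in\mathbb H}$ an isonormal Gaussian process (centered Gaussian with $\mathbb E[W(g)W(h)]=\langle g,h\rangle$), $f\in\mathbb H$ and $\varepsilon>0$. One observes $Y(h)=\langle f,h\rangle+\varepsilon W(h)$, $h\in\mathbb H$. Let $(\phi_j)_{j\ge1}$ be an ordered dictionary in $\mathbb H$ with $\sup_j\|\phi_j\|\le1$; as usual, $W$ is taken in a version whose paths are almost surely linear on the linear span of the dictionary. For $p\ge1$ let $\mathcal L_1(\mathcal D_p)$ be the linear span of $\phi_1,\dots,\phi_p$, with $$\|h\|_{\mathcal L_1(\mathcal D_p)}=\inf\Big\{\sum_{j=1}^p|\theta_j| : \theta\in\mathbb R^p,\ h=\sum_{j=1}^p\theta_j\phi_j\Big\}.$$ *Selected Lasso.* Let $\Lambda=\{2^J : J=0,1,2,\dots\}$, $\gamma(h)=-2Y(h)+\|h\|^2$, $\lambda_p=4\varepsilon(\sqrt{\ln p}+1)$ and $\mathrm{pen}(p)=5\varepsilon^2\ln p$. For $p\in\Lambda$ let $\hat f_p$ be a minimizer of $\gamma(h)+\lambda_p\|h\|_{\mathcal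 L_1(\mathcal D_p)}$ over $h\in\mathcal L_1(\mathcal D_p)$, and let $\hat p$ be a minimizer of $\gamma(\hat f_p)+\lambda_p\|\hat f_p\|_{\mathcal L_1(\mathcal D_p)}+\mathrm{pen}(p)$ over $p\in\Lambda$. The selected Lasso is $\hat f_{\hat p}$ (assumed to be a random variable, i.e. measurable). *Function classes.* For $r>0$, $\mathcal L_{1,r}$ is the set of $g\in\mathbb H$ for which there is $C>0$ such that for every $p\ge1$ there is $g_p\in\mathcal L_1(\mathcal D_p)$ with $\|g_p\|_{\mathcal L_1(\mathcal D_p)}\le C$ and $\|g-g_p\|\le Cp^{-r}$; $\|g\|_{\mathcal L_{1,r}}$ is the infimum of such $C$. For $1<q<2$, $r>0$ and $R>0$, $\mathcal B_{q,r}(R)$ is the set of $g\in\mathbb H$ such that for all $\delta>0$ $$\inf_{h\in\mathcal L_{1,r}}\big(\|g-h\|+\delta\|h\|_{\mathcal L_{1,r}}\big)\le R\,\delta^{2\alpha},\qquad \alpha=\tfrac1q-\tfrac12 .$$ **Proposition 5.7.** For all $1<q<2$ and $r>0$ there is a constant $C_{q,r}>0$ depending only on $q$ and $r$ such that the following holds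 in every setting as above: the selected Lasso, whose construction involves neither $q$, $r$ nor $R$, satisfies simultaneously for all $1<q<2$, $r>0$ and $R>0$ with $f\in\mathcal B_{q,r}(R)$ and $R\varepsilon^{-1}\ge\max\big(e,\tfrac{q}{4r}\big)$ $$\mathbb E\big[\|f-\hat f_{\hat p}\|^2\big]\le C_{q,r}\,R^q\Big(\varepsilon\sqrt{\ln(R\varepsilon^{-1})}\Big)^{2-q}$$ (in particular the expectation is finite). -/

import Mathlib

open MeasureTheory ProbabilityTheory

noncomputable section

namespace SelectedLasso

section Model

/-- A centered Gaussian process `(W h)` indexed by the Hilbert space `H` is isonormal if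
`E[W g * W h] = ⟪g, h⟫` for all `g h`. -/
structure IsIsonormal {H Ω : Type*} [NormedAddCommGroup H] [InnerProductSpace ℝ H]
    [MeasurableSpace Ω] (W : H → Ω → ℝ) (P : Measure Ω) : Prop where
  gaussian : IsGaussianProcess W P
  centered : ∀ h : H, ∫ ω, W h ω ∂P = 0
  covariance : ∀ g h : H, ∫ ω, W g ω * W h ω ∂P = inner ℝ g h

/-- The paths of `W` are almost surely linear on the linear span of the sequence `φ`.
For an isonormal process `W (∑ θ_j φ_j) = ∑ θ_j W (φ_j)` holds almost surely for each fixed `θ`;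
here the version of the process is such that the exceptional null set does not depend on `θ`. -/
def HasLinearPaths {H Ω : Type*} [NormedAddCommGroup H] [InnerProductSpace ℝ H]
    [MeasurableSpace Ω] (φ : ℕ → H) (W : H → Ω → ℝ) (P : Measure Ω) : Prop :=
  ∀ᵐ ω ∂P, ∀ (p : ℕ) (θ : Fin p → ℝ),
    W (∑ j : Fin p, θ j • φ j) ω = ∑ j : Fin p, θ j * W (φ j) ω

/-- The observed process `Y h = ⟪f, h⟫ + ε W h`. -/
def observation {H Ω : Type*} [NormedAddCommGroup H] [InnerProductSpace ℝ H]
    (f : H) (ε : ℝ) (W : H → Ω → ℝ) (ω : Ω) (h : H) : ℝ :=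
  inner ℝ f h + ε * W h ω

/-- The empirical least squares criterion `γ h = -2 Y h + ‖h‖²`. -/
def lsCrit {H : Type*} [NormedAddCommGroup H] (Y : H → ℝ) (h : H) : ℝ :=
  -2 * Y h + ‖h‖ ^ 2

end Model

section Dictionary

variable {H : Type*} [NormedAddCommGroup H] [InnerProductSpace ℝ H]

/-- The space `L₁(D_p)`: the linear span of the first `p` elements of the ordered dictionary.
The dictionary is numbered from `0`: `φ j` is the element of rank `j + 1`, so that
`D_p = {φ 0, …, φ (p - 1)}`. -/
def truncSpan (φ : ℕ → H) (p : ℕ) : Submodule ℝ H :=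
  Submodule.span ℝ (Set.range fun j : Fin p => φ j)

/-- The `ℓ₁`-norm of `h ∈ L₁(D_p)`: the infimum of `∑ |θ_j|` over all `θ ∈ ℝ^p` such that
`h = ∑ θ_j φ_j`. It is only meant for `h ∈ truncSpan φ p`. -/
def l1Norm (φ : ℕ → H) (p : ℕ) (h : H) : ℝ :=
  sInf {x : ℝ | ∃ θ : Fin p → ℝ, h = ∑ j : Fin p, θ j • φ j ∧ x = ∑ j : Fin p, |θ j|}

/-- `h` minimizes `γ + lam * ‖·‖_{L₁(D_p)}` over `L₁(D_p)`, where `γ` is the least squares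
criterion built on the data `Y`. -/
def IsLasso (φ : ℕ → H) (Y : H → ℝ) (p : ℕ) (lam : ℝ) (h : H) : Prop :=
  h ∈ truncSpan φ p ∧ ∀ g ∈ truncSpan φ p,
    lsCrit Y h + lam * l1Norm φ p h ≤ lsCrit Y g + lam * l1Norm φ p g

/-- The set of dyadic integers `{2^J : J ∈ ℕ}`. -/
def dyadic : Set ℕ := {p | ∃ J : ℕ, p = 2 ^ J}

/-- The regularization parameter `λ_p = 4 ε (√(ln p) + 1)`. -/
def lassoLevel (ε : ℝ) (p : ℕ) : ℝ := 4 * ε * (Real.sqrt (Real.log p) + 1)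

/-- The penalty `pen(p) = 5 ε² ln p` on the size of the truncated dictionary. -/
def sizePen (ε : ℝ) (p : ℕ) : ℝ := 5 * ε ^ 2 * Real.log p

/-- `fhat p` is the Lasso on `D_p` with parameter `λ_p`, for every dyadic `p`, and the dyadic
integer `phat` minimizes `γ(fhat p) + λ_p ‖fhat p‖_{L₁(D_p)} + pen(p)` over all dyadic `p`.
The selected Lasso is then `fhat phat`. -/
structure IsSelectedLasso (φ : ℕ → H) (Y : H → ℝ) (ε : ℝ) (fhat : ℕ → H) (phat : ℕ) :
    Prop where
  lasso : ∀ p ∈ dyadic, IsLasso φ Y p (lassoLevel ε p) (fhat p)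
  mem : phat ∈ dyadic
  minimal : ∀ p ∈ dyadic,
    lsCrit Y (fhat phat) + lassoLevel ε phat * l1Norm φ phat (fhat phat) + sizePen ε phat ≤
      lsCrit Y (fhat p) + lassoLevel ε p * l1Norm φ p (fhat p) + sizePen ε p

/-- The set of constants `C > 0` such that for every `p ≥ 1` there is `g_p ∈ L₁(D_p)` with
`‖g_p‖_{L₁(D_p)} ≤ C` and `‖g - g_p‖ ≤ C p^{-r}`. -/
def l1rConstants (φ : ℕ → H) (r : ℝ) (g : H) : Set ℝ :=
  {C : ℝ | 0 < C ∧ ∀ p : ℕ, 1 ≤ p → ∃ gp ∈ truncSpan φ p,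
    l1Norm φ p gp ≤ C ∧ ‖g - gp‖ ≤ C * (p : ℝ) ^ (-r)}

/-- The space `L_{1,r}`. -/
def l1rSpace (φ : ℕ → H) (r : ℝ) : Set H := {g | (l1rConstants φ r g).Nonempty}

/-- The norm of `L_{1,r}`. It is only meant for elements of `l1rSpace φ r`. -/
def l1rNorm (φ : ℕ → H) (r : ℝ) (g : H) : ℝ := sInf (l1rConstants φ r g)

/-- The class `B_{q,r}(R)`: for every `δ > 0`, the infimum over `h ∈ L_{1,r}` of
`‖g - h‖ + δ ‖h‖_{L_{1,r}}` is at most `R δ^{2α}`, where `α = 1/q - 1/2`. -/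
def bqr (φ : ℕ → H) (q r R : ℝ) : Set H :=
  {g | ∀ δ : ℝ, 0 < δ →
    sInf ((fun h : H => ‖g - h‖ + δ * l1rNorm φ r h) '' l1rSpace φ r) ≤
      R * δ ^ (2 * (1 / q - 1 / 2))}

end Dictionary

end SelectedLasso

end

/-! Fix a noise path `w` linear on the dictionary span. Minimality bounds the penalized criterion of
the selected Lasso by that of any `g` in any dyadic `truncSpan φ p`; only the noise term `2 ε w
(fhat phat)` must be controlled. If `|w (φ j)| ≤ noiseLevel phat` for all `j < phat`, the Lasso
penalty absorbs it. Otherwise Cauchy–Schwarz bounds it through the projected noise norm, and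
`excess` dominates the square of that norm on the bad event. The expected excess at `p` is of order
`exp (-2 √(ln p))`, summable over `p = 2 ^ J`, so the random `phat` costs only the constant
`excessConst`. This gives the oracle inequality `integrable_sq_norm_sub_and_integral_le`.

For the rate, `exists_oracle_le_rate` chooses `δ` to balance squared bias against noise level times
ℓ₁-norm, and a dyadic `p` so large that truncation costs no more than the bias. Both enter only
through the comparison element, so the estimator needs no knowledge of the class. -/

noncomputable section

namespace SelectedLasso

/-! ### Gaussian moments and truncated second moments. -/

section Gaussian

variable {H Ω : Type*} [NormedAddCommGroup H] [InnerProductSpace ℝ H] [MeasurableSpace Ω]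
  {P : Measure Ω} {W : H → Ω → ℝ}

theorem IsIsonormal.map_eq (hW : IsIsonormal W P) (h : H) :
    P.map (W h) = gaussianReal 0 (‖h‖ ^ 2).toNNReal := by
  have hG := hW.gaussian.hasGaussianLaw_eval h
  have hv : Var[W h; P] = ‖h‖ ^ 2 := by
    rw [variance_of_integral_eq_zero hG.aemeasurable (hW.centered h)]
    rw [← real_inner_self_eq_norm_sq, ← hW.covariance h h]
    simp [pow_two]
  rw [hG.map_eq_gaussianReal, hW.centered h, hv]

theorem IsIsonormal.integrable_exp (hW : IsIsonormal W P) (h : H) (s : ℝ) :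
    Integrable (fun ω => Real.exp (s * W h ω)) P := by
  have h1 := integrable_exp_mul_gaussianReal (μ := 0) (v := (‖h‖ ^ 2).toNNReal) s
  rw [← hW.map_eq h] at h1
  exact h1.comp_aemeasurable (hW.gaussian.aemeasurable h)

theorem IsIsonormal.integral_exp (hW : IsIsonormal W P) (h : H) (s : ℝ) :
    ∫ ω, Real.exp (s * W h ω) ∂P = Real.exp (‖h‖ ^ 2 * s ^ 2 / 2) := by
  have h1 := mgf_gaussianReal (hW.map_eq h) s
  simpa [mgf, Real.coe_toNNReal _ (sq_nonneg ‖h‖)] using h1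

theorem IsIsonormal.integrable_sq (hW : IsIsonormal W P) (h : H) :
    Integrable (fun ω => W h ω ^ 2) P :=
  (hW.gaussian.hasGaussianLaw_eval h).memLp_two.integrable_sq

theorem IsIsonormal.integral_sq (hW : IsIsonormal W P) (h : H) :
    ∫ ω, W h ω ^ 2 ∂P = ‖h‖ ^ 2 := by
  rw [← real_inner_self_eq_norm_sq, ← hW.covariance h h]
  simp [pow_two]

/-- A smooth majorant of `x ^ 2` on `{|x| > t}`, whose Gaussian expectation is explicit. -/
def tailMajorant (t x : ℝ) : ℝ :=
  Real.exp (-t ^ 2) * ((Real.exp x + Real.exp (-x)) * (Real.exp (t * x) + Real.exp (-(t * x))))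

theorem tailMajorant_nonneg (t x : ℝ) : 0 ≤ tailMajorant t x := by
  unfold tailMajorant; positivity

/-- From `cosh x = 1 + 2 sinh² (x / 2)` and `|sinh u| ≥ |u|`. -/
theorem sq_le_exp_add_exp_neg (x : ℝ) : x ^ 2 ≤ Real.exp x + Real.exp (-x) := by
  have h1 : |x / 2| ≤ |Real.sinh (x / 2)| := by
    rw [Real.abs_sinh]
    exact Real.self_le_sinh_iff.2 (abs_nonneg _)
  have h2 := sq_le_sq.2 h1
  have h3 := Real.cosh_two_mul (x / 2)
  rw [Real.cosh_sq, mul_div_cancel₀ x two_ne_zero, Real.cosh_eq] at h3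
  linarith

theorem sq_le_tailMajorant {t x : ℝ} (ht : 0 ≤ t) (hx : t < |x|) : x ^ 2 ≤ tailMajorant t x := by
  have h1 := sq_le_exp_add_exp_neg x
  have h2 : Real.exp (t ^ 2) ≤ Real.exp (t * x) + Real.exp (-(t * x)) := by
    rcases lt_abs.1 hx with h | h
    · have : Real.exp (t ^ 2) ≤ Real.exp (t * x) := Real.exp_le_exp.2 (by nlinarith)
      linarith [Real.exp_pos (-(t * x))]
    · have : Real.exp (t ^ 2) ≤ Real.exp (-(t * x)) := Real.exp_le_exp.2 (by nlinarith)
      linarith [Real.exp_pos (t * x)]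
  have h3 : x ^ 2 * Real.exp (t ^ 2) ≤
      (Real.exp x + Real.exp (-x)) * (Real.exp (t * x) + Real.exp (-(t * x))) := by
    gcongr
  calc x ^ 2 = Real.exp (-t ^ 2) * (x ^ 2 * Real.exp (t ^ 2)) := by
        rw [mul_left_comm, ← Real.exp_add]; simp
    _ ≤ _ := by unfold tailMajorant; gcongr

/-- The larger of `|x|`, `|y|` exceeds `t` and dominates `|x|`. Each majorant involves one variable
only, so the joint law of the two is never needed. -/
theorem sq_le_tailMajorant_add {t x y : ℝ} (ht : 0 ≤ t) (hy : t < |y|) :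
    x ^ 2 ≤ tailMajorant t x + tailMajorant t y := by
  rcases le_total |x| |y| with h | h
  · have := sq_le_tailMajorant ht hy
    have := sq_le_sq.2 h
    linarith [tailMajorant_nonneg t x]
  · have := sq_le_tailMajorant ht (hy.trans_le h)
    linarith [tailMajorant_nonneg t y]

theorem tailMajorant_eq (t x : ℝ) : tailMajorant t x = Real.exp (-t ^ 2) *
    (Real.exp ((t + 1) * x) + Real.exp ((1 - t) * x) + Real.exp ((t - 1) * x) +
      Real.exp ((-(t + 1)) * x)) := by
  unfold tailMajorant
  congr 1
  rw [add_mul, mul_add, mul_add]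
  simp_rw [← Real.exp_add]
  ring_nf

theorem IsIsonormal.integrable_tailMajorant (hW : IsIsonormal W P) (t : ℝ) (h : H) :
    Integrable (fun ω => tailMajorant t (W h ω)) P := by
  simp_rw [tailMajorant_eq]
  exact ((((hW.integrable_exp h _).add (hW.integrable_exp h _)).add
    (hW.integrable_exp h _)).add (hW.integrable_exp h _)).const_mul _

theorem IsIsonormal.integral_tailMajorant_le (hW : IsIsonormal W P) {t : ℝ} (ht : 0 ≤ t) {h : H}
    (hh : ‖h‖ ≤ 1) :
    ∫ ω, tailMajorant t (W h ω) ∂P ≤ 4 * Real.exp (t - t ^ 2 / 2 + 1 / 2) := by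
  simp_rw [tailMajorant_eq]
  have I := hW.integrable_exp h
  rw [integral_const_mul, integral_add (by exact ((I _).add (I _)).add (I _)) (I _),
    integral_add (by exact (I _).add (I _)) (I _), integral_add (I _) (I _)]
  simp_rw [hW.integral_exp]
  have hh2 : ‖h‖ ^ 2 ≤ 1 := by nlinarith [norm_nonneg h]
  -- All four exponents lie in `[-(t + 1), t + 1]`, and `(t + 1)² / 2 - t² = t - t² / 2 + 1 / 2`.
  have key : ∀ s : ℝ, s ^ 2 ≤ (t + 1) ^ 2 →
      Real.exp (‖h‖ ^ 2 * s ^ 2 / 2) ≤ Real.exp ((t + 1) ^ 2 / 2) := by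
    intro s hs
    apply Real.exp_le_exp.2
    nlinarith [mul_le_mul hh2 hs (sq_nonneg s) zero_le_one]
  have e : Real.exp (t - t ^ 2 / 2 + 1 / 2) = Real.exp (-t ^ 2) * Real.exp ((t + 1) ^ 2 / 2) := by
    rw [← Real.exp_add]; ring_nf
  rw [e]
  have k1 := key (t + 1) le_rfl
  have k2 := key (1 - t) (by nlinarith)
  have k3 := key (t - 1) (by nlinarith)
  have k4 := key (-(t + 1)) (by nlinarith)
  nlinarith [Real.exp_pos (-t ^ 2), mul_le_mul_of_nonneg_left k1 (Real.exp_pos (-t ^ 2)).le,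
    mul_le_mul_of_nonneg_left k2 (Real.exp_pos (-t ^ 2)).le,
    mul_le_mul_of_nonneg_left k3 (Real.exp_pos (-t ^ 2)).le,
    mul_le_mul_of_nonneg_left k4 (Real.exp_pos (-t ^ 2)).le]

end Gaussian

/-! ### Deterministic noise bounds on the truncated spans. -/

section Span

variable {H Ω : Type*} [NormedAddCommGroup H] [InnerProductSpace ℝ H]
  {φ : ℕ → H}

theorem mem_truncSpan_iff {p : ℕ} {h : H} :
    h ∈ truncSpan φ p ↔ ∃ θ : Fin p → ℝ, h = ∑ j : Fin p, θ j • φ j := by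
  unfold truncSpan
  rw [Submodule.mem_span_range_iff_exists_fun]
  exact ⟨fun ⟨θ, h⟩ => ⟨θ, h.symm⟩, fun ⟨θ, h⟩ => ⟨θ, h.symm⟩⟩

instance (φ : ℕ → H) (p : ℕ) : FiniteDimensional ℝ (truncSpan φ p) :=
  FiniteDimensional.span_of_finite ℝ (Set.finite_range _)

theorem finrank_truncSpan_le (φ : ℕ → H) (p : ℕ) : Module.finrank ℝ (truncSpan φ p) ≤ p := by
  exact (finrank_range_le_card (R := ℝ) (fun j : Fin p => φ j)).trans_eq (Fintype.card_fin p)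

theorem apply_mem_truncSpan {p j : ℕ} (hj : j < p) : φ j ∈ truncSpan φ p :=
  Submodule.subset_span ⟨⟨j, hj⟩, rfl⟩

theorem le_l1Norm {p : ℕ} {h : H} (hh : h ∈ truncSpan φ p) {c : ℝ}
    (hc : ∀ θ : Fin p → ℝ, h = ∑ j : Fin p, θ j • φ j → c ≤ ∑ j : Fin p, |θ j|) :
    c ≤ l1Norm φ p h := by
  obtain ⟨θ, hθ⟩ := mem_truncSpan_iff.1 hh
  refine le_csInf ⟨_, θ, hθ, rfl⟩ ?_
  rintro _ ⟨θ', h', rfl⟩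
  exact hc θ' h'

theorem norm_le_l1Norm (hφ : ∀ j, ‖φ j‖ ≤ 1) {p : ℕ} {h : H} (hh : h ∈ truncSpan φ p) :
    ‖h‖ ≤ l1Norm φ p h := by
  refine le_l1Norm hh fun θ hθ => ?_
  rw [hθ]
  refine (norm_sum_le _ _).trans (Finset.sum_le_sum fun j _ => ?_)
  rw [norm_smul, Real.norm_eq_abs]
  exact mul_le_of_le_one_right (abs_nonneg _) (hφ _)

theorem l1Norm_nonneg (φ : ℕ → H) (p : ℕ) (h : H) : 0 ≤ l1Norm φ p h := by
  apply Real.sInf_nonneg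
  rintro _ ⟨θ, -, rfl⟩
  exact Finset.sum_nonneg fun _ _ => abs_nonneg _

/-- An orthonormal basis of `truncSpan φ p`, viewed in the ambient space. -/
def spanBasis (φ : ℕ → H) (p : ℕ) (i : Fin (Module.finrank ℝ (truncSpan φ p))) : H :=
  (stdOrthonormalBasis ℝ (truncSpan φ p) i : truncSpan φ p)

theorem spanBasis_mem (φ : ℕ → H) (p : ℕ) (i) : spanBasis φ p i ∈ truncSpan φ p :=
  (stdOrthonormalBasis ℝ (truncSpan φ p) i).2

theorem norm_spanBasis (φ : ℕ → H) (p : ℕ) (i) : ‖spanBasis φ p i‖ = 1 :=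
  (stdOrthonormalBasis ℝ (truncSpan φ p)).orthonormal.1 i

variable {w : H → ℝ}

/-- Transfers linearity from the dictionary to other vectors of the span, in particular to the
orthonormal basis used in Cauchy–Schwarz. -/
theorem linear_combination_of_linear_paths
    (hw : ∀ (p : ℕ) (θ : Fin p → ℝ), w (∑ j : Fin p, θ j • φ j) = ∑ j : Fin p, θ j * w (φ j))
    {p : ℕ} {ι : Type*} [Fintype ι] (e : ι → H) (he : ∀ i, e i ∈ truncSpan φ p) (c : ι → ℝ) :
    w (∑ i, c i • e i) = ∑ i, c i * w (e i) := by
  choose A hA using fun i => mem_truncSpan_iff.1 (he i)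
  have h1 : ∑ i, c i • e i = ∑ j : Fin p, (∑ i, c i * A i j) • φ j := by
    simp_rw [hA, Finset.smul_sum, Finset.sum_smul, smul_smul]
    exact Finset.sum_comm
  have h2 : ∀ i, w (e i) = ∑ j : Fin p, A i j * w (φ j) := fun i => by
    conv_lhs => rw [hA i]
    exact hw p (A i)
  rw [h1, hw]
  simp_rw [h2, Finset.mul_sum, Finset.sum_mul, mul_assoc]
  exact Finset.sum_comm

/-- Cauchy–Schwarz for the noise on `truncSpan φ p`. -/
theorem noise_le_norm_mul_sqrt
    (hw : ∀ (p : ℕ) (θ : Fin p → ℝ), w (∑ j : Fin p, θ j • φ j) = ∑ j : Fin p, θ j * w (φ j))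
    {p : ℕ} {h : H} (hh : h ∈ truncSpan φ p) :
    |w h| ≤ ‖h‖ * Real.sqrt (∑ i, w (spanBasis φ p i) ^ 2) := by
  set b := stdOrthonormalBasis ℝ (truncSpan φ p)
  let c : Fin (Module.finrank ℝ (truncSpan φ p)) → ℝ := fun i =>
    inner ℝ (b i) (⟨h, hh⟩ : truncSpan φ p)
  have h1 : h = ∑ i, c i • spanBasis φ p i := by
    have := congrArg (Subtype.val) (b.sum_repr' ⟨h, hh⟩)
    simpa [spanBasis, c, b] using this.symm
  have h2 : ‖h‖ ^ 2 = ∑ i, c i ^ 2 := by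
    have := b.sum_sq_norm_inner_right ⟨h, hh⟩
    simpa [c] using this.symm
  have h3 : w h = ∑ i, c i * w (spanBasis φ p i) := by
    conv_lhs => rw [h1]
    exact linear_combination_of_linear_paths hw _ (spanBasis_mem φ p) c
  have h4 := Finset.sum_mul_sq_le_sq_mul_sq Finset.univ c (fun i => w (spanBasis φ p i))
  rw [← h3, ← h2] at h4
  have := Real.abs_le_sqrt h4
  rwa [Real.sqrt_mul (sq_nonneg _), Real.sqrt_sq (norm_nonneg _)] at this

/-- ℓ₁–ℓ∞ duality for each representation of `h`, then the infimum over representations. -/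
theorem noise_le_mul_l1Norm
    (hw : ∀ (p : ℕ) (θ : Fin p → ℝ), w (∑ j : Fin p, θ j • φ j) = ∑ j : Fin p, θ j * w (φ j))
    {p : ℕ} {h : H} (hh : h ∈ truncSpan φ p) {t : ℝ} (ht : 0 < t)
    (hφ : ∀ j < p, |w (φ j)| ≤ t) : w h ≤ t * l1Norm φ p h := by
  rw [← div_le_iff₀' ht]
  refine le_l1Norm hh fun θ hθ => ?_
  rw [div_le_iff₀' ht, hθ, hw, Finset.mul_sum]
  refine Finset.sum_le_sum fun j _ => ?_
  refine (le_abs_self _).trans ?_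
  rw [abs_mul, mul_comm]
  exact mul_le_mul_of_nonneg_right (hφ j j.2) (abs_nonneg _)

/-- The threshold `2 (√(ln p) + 1)` above which the noise is too large for the level `λ_p`. -/
def noiseLevel (p : ℕ) : ℝ := 2 * (Real.sqrt (Real.log p) + 1)

theorem two_le_noiseLevel (p : ℕ) : 2 ≤ noiseLevel p := by
  unfold noiseLevel; linarith [Real.sqrt_nonneg (Real.log p)]

/-- A majorant of the squared norm of the projected noise on the event that the noise exceeds
`noiseLevel p` at some element of the truncated dictionary. -/
def excess (φ : ℕ → H) (w : H → ℝ) (p : ℕ) : ℝ :=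
  ∑ i, ∑ j : Fin p, (tailMajorant (noiseLevel p) (w (spanBasis φ p i)) +
    tailMajorant (noiseLevel p) (w (φ j)))

theorem excess_nonneg (φ : ℕ → H) (w : H → ℝ) (p : ℕ) : 0 ≤ excess φ w p :=
  Finset.sum_nonneg fun _ _ => Finset.sum_nonneg fun _ _ =>
    add_nonneg (tailMajorant_nonneg _ _) (tailMajorant_nonneg _ _)

theorem sum_sq_le_excess {p : ℕ} {j : ℕ} (hj : j < p) (hw : noiseLevel p < |w (φ j)|) :
    ∑ i, w (spanBasis φ p i) ^ 2 ≤ excess φ w p := by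
  refine Finset.sum_le_sum fun i _ => ?_
  refine (sq_le_tailMajorant_add (by linarith [two_le_noiseLevel p]) hw).trans ?_
  exact Finset.single_le_sum (f := fun j : Fin p =>
    tailMajorant (noiseLevel p) (w (spanBasis φ p i)) + tailMajorant (noiseLevel p) (w (φ j)))
    (fun _ _ => add_nonneg (tailMajorant_nonneg _ _) (tailMajorant_nonneg _ _))
    (Finset.mem_univ (⟨j, hj⟩ : Fin p))

end Span

/-! ### Expected excess and its summability over dyadic ranks. -/

section Excess

variable {H Ω : Type*} [NormedAddCommGroup H] [InnerProductSpace ℝ H] [MeasurableSpace Ω]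
  {P : Measure Ω} {W : H → Ω → ℝ} {φ : ℕ → H}

theorem IsIsonormal.integrable_excess (hW : IsIsonormal W P) (φ : ℕ → H) (p : ℕ) :
    Integrable (fun ω => excess φ (fun h => W h ω) p) P :=
  integrable_finsetSum _ fun _ _ => integrable_finsetSum _ fun _ _ =>
    (hW.integrable_tailMajorant _ _).add (hW.integrable_tailMajorant _ _)

/-- There are at most `p²` pairs, and at `t = noiseLevel p` one has `t - t² / 2 = -2 ln p - 2 √(ln
p)`: the first term cancels `p²` exactly, the second is the gain. -/
theorem IsIsonormal.integral_excess_le (hW : IsIsonormal W P) (hφ : ∀ j, ‖φ j‖ ≤ 1) {p : ℕ}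
    (hp : 1 ≤ p) :
    ∫ ω, excess φ (fun h => W h ω) p ∂P ≤
      8 * Real.exp (1 / 2 - 2 * Real.sqrt (Real.log p)) := by
  have ht : 0 ≤ noiseLevel p := by linarith [two_le_noiseLevel p]
  set B := 4 * Real.exp (noiseLevel p - noiseLevel p ^ 2 / 2 + 1 / 2) with hB
  have hB0 : 0 ≤ B := by positivity
  have hI : ∀ i, ∀ j : Fin p, Integrable (fun ω =>
      tailMajorant (noiseLevel p) (W (spanBasis φ p i) ω) +
        tailMajorant (noiseLevel p) (W (φ j) ω)) P := fun i j =>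
    (hW.integrable_tailMajorant _ _).add (hW.integrable_tailMajorant _ _)
  have h1 : ∫ ω, excess φ (fun h => W h ω) p ∂P ≤
      ∑ _i : Fin (Module.finrank ℝ (truncSpan φ p)), ∑ _j : Fin p, (B + B) := by
    unfold excess
    rw [integral_finsetSum _ fun i _ => integrable_finsetSum _ fun j _ => hI i j]
    refine Finset.sum_le_sum fun i _ => ?_
    rw [integral_finsetSum _ fun j _ => hI i j]
    refine Finset.sum_le_sum fun j _ => ?_
    rw [integral_add (hW.integrable_tailMajorant _ _) (hW.integrable_tailMajorant _ _)]
    exact add_le_add (hW.integral_tailMajorant_le ht (norm_spanBasis φ p i).le)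
      (hW.integral_tailMajorant_le ht (hφ j))
  refine h1.trans ?_
  simp only [Finset.sum_const, Finset.card_univ, Fintype.card_fin, nsmul_eq_mul]
  have hp0 : (0 : ℝ) < p := by exact_mod_cast hp
  have h2 : ((Module.finrank ℝ (truncSpan φ p) : ℕ) : ℝ) * (p * (B + B)) ≤ p * (p * (B + B)) := by
    gcongr
    exact finrank_truncSpan_le φ p
  refine h2.trans (le_of_eq ?_)
  have hl : 0 ≤ Real.log p := Real.log_nonneg (by exact_mod_cast hp)
  have e1 : (p : ℝ) = Real.exp (Real.log p) := (Real.exp_log hp0).symm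
  have e2 := Real.sq_sqrt hl
  calc (p : ℝ) * (p * (B + B)) = 8 * (Real.exp (Real.log p) * (Real.exp (Real.log p) *
        Real.exp (noiseLevel p - noiseLevel p ^ 2 / 2 + 1 / 2))) := by
          rw [hB, ← e1]; ring
    _ = _ := by
          rw [← Real.exp_add, ← Real.exp_add]
          congr 2
          unfold noiseLevel
          linear_combination (-2) * e2

theorem summable_exp_neg_sqrt_log_two_pow :
    Summable fun J : ℕ => 8 * Real.exp (1 / 2 - 2 * Real.sqrt (Real.log ((2 ^ J : ℕ) : ℝ))) := by
  apply Summable.mul_left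
  simp_rw [sub_eq_add_neg, Real.exp_add]
  apply Summable.mul_left
  -- Drops `J = 0`, where the comparison series `1 / J²` is no bound.
  rw [← summable_nat_add_iff 1]
  have hl : 0 < Real.log 2 := Real.log_pos (by norm_num)
  have hs : Summable fun J : ℕ => 24 / (16 * Real.log 2 ^ 2) * (1 / ((J + 1 : ℕ) : ℝ) ^ 2) :=
    ((summable_nat_add_iff 1).2 (Real.summable_one_div_nat_pow.2 one_lt_two)).mul_left _
  refine Summable.of_nonneg_of_le (fun _ => (Real.exp_pos _).le) (fun J => ?_) hs
  set n : ℕ := J + 1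
  have hn : (0 : ℝ) < n := by positivity
  have e1 : Real.log ((2 ^ n : ℕ) : ℝ) = n * Real.log 2 := by
    push_cast; rw [Real.log_pow]
  rw [e1]
  set y := Real.sqrt (n * Real.log 2) with hy
  have hy0 : 0 < y := Real.sqrt_pos.2 (by positivity)
  have h2 : y ^ 2 = n * Real.log 2 := Real.sq_sqrt (by positivity)
  -- Since `y²` is linear in `n`, the fourth-order term of the exponential gives decay `n⁻²`.
  have h3 := Real.pow_div_factorial_le_exp (2 * y) (by positivity) 4
  have h4 : (2 * y) ^ 4 / (Nat.factorial 4 : ℝ) = 16 * (n * Real.log 2) ^ 2 / 24 := by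
    rw [← h2]; norm_num [Nat.factorial]; ring
  rw [h4] at h3
  rw [Real.exp_neg]
  calc (Real.exp (2 * y))⁻¹ ≤ (16 * (n * Real.log 2) ^ 2 / 24)⁻¹ := by
        apply inv_anti₀ (by positivity) h3
    _ = _ := by field_simp

/-- The expected total excess over all dyadic integers is at most this absolute constant. -/
def excessConst : ℝ :=
  ∑' J : ℕ, 8 * Real.exp (1 / 2 - 2 * Real.sqrt (Real.log ((2 ^ J : ℕ) : ℝ)))

theorem excessConst_nonneg : 0 ≤ excessConst :=
  tsum_nonneg fun _ => by positivity

theorem IsIsonormal.tsum_lintegral_excess_le (hW : IsIsonormal W P) (hφ : ∀ j, ‖φ j‖ ≤ 1) :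
    ∑' J : ℕ, ∫⁻ ω, ENNReal.ofReal (excess φ (fun h => W h ω) (2 ^ J)) ∂P ≤
      ENNReal.ofReal excessConst := by
  unfold excessConst
  rw [ENNReal.ofReal_tsum_of_nonneg (fun _ => by positivity) summable_exp_neg_sqrt_log_two_pow]
  refine ENNReal.tsum_le_tsum fun J => ?_
  rw [← ofReal_integral_eq_lintegral_ofReal (hW.integrable_excess φ _)
    (Filter.Eventually.of_forall fun ω => excess_nonneg _ _ _)]
  exact ENNReal.ofReal_le_ofReal (hW.integral_excess_le hφ Nat.one_le_two_pow)

end Excess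

/-! ### Oracle inequality, pathwise and in expectation. -/

section Oracle

variable {H Ω : Type*} [NormedAddCommGroup H] [InnerProductSpace ℝ H] {φ : ℕ → H}

theorem lsCrit_eq (f : H) (ε : ℝ) (w : H → ℝ) (h : H) :
    lsCrit (fun h => inner ℝ f h + ε * w h) h = ‖f - h‖ ^ 2 - ‖f‖ ^ 2 - 2 * ε * w h := by
  unfold lsCrit
  rw [norm_sub_sq_real]
  ring

theorem one_le_of_mem_dyadic {p : ℕ} (hp : p ∈ dyadic) : 1 ≤ p := by
  obtain ⟨J, rfl⟩ := hp
  exact Nat.one_le_two_pow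

theorem lassoLevel_eq (ε : ℝ) (p : ℕ) : lassoLevel ε p = 2 * ε * noiseLevel p := by
  unfold lassoLevel noiseLevel; ring

theorem sizePen_nonneg (ε : ℝ) (p : ℕ) : 0 ≤ sizePen ε p :=
  mul_nonneg (by positivity) (Real.log_natCast_nonneg p)

/-- The oracle inequality for a fixed realization `w` of the noise. -/
theorem IsSelectedLasso.sq_norm_sub_le {w : H → ℝ} {f : H} {ε : ℝ} {fhat : ℕ → H} {phat : ℕ}
    (hw : ∀ (p : ℕ) (θ : Fin p → ℝ), w (∑ j : Fin p, θ j • φ j) = ∑ j : Fin p, θ j * w (φ j))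
    (hφ : ∀ j, ‖φ j‖ ≤ 1) (hε : 0 < ε)
    (hS : IsSelectedLasso φ (fun h => inner ℝ f h + ε * w h) ε fhat phat)
    {p : ℕ} (hp : p ∈ dyadic) {g : H} (hg : g ∈ truncSpan φ p) {c : ℝ} (hc : 0 < c)
    (hgc : l1Norm φ p g ≤ c) :
    ‖f - fhat phat‖ ^ 2 ≤ (3 * ‖f - g‖ ^ 2 + 2 * lassoLevel ε p * c + 2 * sizePen ε p + 2 * ε * c) +
      2 * ε / c * w g ^ 2 + (8 * ε ^ 2 + 4 * ε * c) * excess φ w phat := by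
  obtain ⟨hmem, -⟩ := hS.lasso phat hS.mem
  have h1 := (hS.minimal p hp).trans (add_le_add_left ((hS.lasso p hp).2 g hg) _)
  rw [lsCrit_eq, lsCrit_eq] at h1
  have hlam : 0 ≤ lassoLevel ε p := by
    rw [lassoLevel_eq]; have := two_le_noiseLevel p; positivity
  have h2 : lassoLevel ε p * l1Norm φ p g ≤ lassoLevel ε p * c :=
    mul_le_mul_of_nonneg_left hgc hlam
  -- The weight `c` makes both terms of order `c` in expectation, as `E[W(g)²] = ‖g‖² ≤ c²`.
  have hwg : 2 * |w g| ≤ c + w g ^ 2 / c := by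
    rw [← sub_nonneg]
    have : c + w g ^ 2 / c - 2 * |w g| = (c - |w g|) ^ 2 / c := by
      rw [← sq_abs (w g)]; field_simp; ring
    rw [this]; positivity
  have hwg2 : 2 * ε * (2 * |w g|) ≤ 2 * ε * c + 2 * ε / c * w g ^ 2 :=
    (mul_le_mul_of_nonneg_left hwg (by positivity)).trans_eq (by ring)
  have hwg3 : -(2 * ε * w g) ≤ 2 * ε * |w g| := by
    nlinarith [neg_abs_le (w g)]
  have hwg0 : 0 ≤ 2 * ε * |w g| := by positivity
  have hpen := sizePen_nonneg ε phat
  have hpen' := sizePen_nonneg ε p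
  have hl : 0 ≤ l1Norm φ phat (fhat phat) := l1Norm_nonneg _ _ _
  have hE := excess_nonneg φ w phat
  have hE' : 0 ≤ (8 * ε ^ 2 + 4 * ε * c) * excess φ w phat := by positivity
  have hlc : 0 ≤ lassoLevel ε p * c := by positivity
  by_cases hgood : ∀ j < phat, |w (φ j)| ≤ noiseLevel phat
  · have h3 := noise_le_mul_l1Norm hw hmem (by linarith [two_le_noiseLevel phat]) hgood
    have h4 : 2 * ε * w (fhat phat) ≤ lassoLevel ε phat * l1Norm φ phat (fhat phat) := by
      rw [lassoLevel_eq, mul_assoc (2 * ε)]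
      exact mul_le_mul_of_nonneg_left h3 (by positivity)
    linarith [sq_nonneg ‖f - g‖]
  · push Not at hgood
    obtain ⟨j, hj, hj2⟩ := hgood
    have h3 := sum_sq_le_excess hj hj2
    have hZ := noise_le_norm_mul_sqrt hw hmem
    have hZj := noise_le_norm_mul_sqrt hw (apply_mem_truncSpan hj)
    have hZ2 := Real.sq_sqrt (Finset.sum_nonneg fun i (_ : i ∈ Finset.univ) =>
      sq_nonneg (w (spanBasis φ phat i)))
    set Z := Real.sqrt (∑ i, w (spanBasis φ phat i) ^ 2)
    have hZ0 : 0 ≤ Z := Real.sqrt_nonneg _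
    rw [← hZ2] at h3
    -- A violating `φ j` has norm at most 1, so `Z` exceeds the threshold, itself at least 2; hence
    -- the linear term `c ε Z` can be replaced by `c ε Z²`.
    have hZ1 : 1 ≤ Z := by
      have := mul_le_of_le_one_left hZ0 (hφ j)
      linarith [two_le_noiseLevel phat]
    have hgn : ‖g‖ ≤ c := (norm_le_l1Norm hφ hg).trans hgc
    have htri : ‖fhat phat‖ ≤ ‖f - fhat phat‖ + ‖f - g‖ + c := by
      have e : fhat phat = -(f - fhat phat) + (f - g) + g := by abel
      calc ‖fhat phat‖ = ‖-(f - fhat phat) + (f - g) + g‖ := by rw [← e]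
        _ ≤ _ := (norm_add₃_le).trans (by rw [norm_neg]; linarith)
    have h5 : 2 * ε * w (fhat phat) ≤ 2 * ε * ((‖f - fhat phat‖ + ‖f - g‖ + c) * Z) := by
      refine mul_le_mul_of_nonneg_left ((le_abs_self _).trans (hZ.trans ?_)) (by positivity)
      exact mul_le_mul_of_nonneg_right htri hZ0
    have hlamh : 0 ≤ lassoLevel ε phat * l1Norm φ phat (fhat phat) := by
      rw [lassoLevel_eq]; have := two_le_noiseLevel phat; positivity
    have h6 : c * ε * Z ≤ c * ε * Z ^ 2 :=
      mul_le_mul_of_nonneg_left (by nlinarith) (by positivity)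
    have h7 : (8 * ε ^ 2 + 4 * ε * c) * Z ^ 2 ≤ (8 * ε ^ 2 + 4 * ε * c) * excess φ w phat :=
      mul_le_mul_of_nonneg_left h3 (by positivity)
    -- The squares split the products with `Z`; half of `‖f - fhat phat‖²` is absorbed on the left,
    -- and doubling yields the factors 3 and 2.
    nlinarith [sq_nonneg (‖f - fhat phat‖ - 2 * ε * Z), sq_nonneg (‖f - g‖ - 2 * ε * Z)]

variable [MeasurableSpace Ω] {P : Measure Ω} {W : H → Ω → ℝ}

/-- The oracle inequality for the selected Lasso. -/
theorem integrable_sq_norm_sub_and_integral_le [IsProbabilityMeasure P] (hW : IsIsonormal W P)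
    (hlin : HasLinearPaths φ W P) (hφ : ∀ j, ‖φ j‖ ≤ 1) {f : H} {ε : ℝ} (hε : 0 < ε)
    {fhat : ℕ → Ω → H} {phat : Ω → ℕ}
    (hS : ∀ᵐ ω ∂P, IsSelectedLasso φ (observation f ε W ω) ε (fun p => fhat p ω) (phat ω))
    (hm : AEStronglyMeasurable (fun ω => fhat (phat ω) ω) P)
    {p : ℕ} (hp : p ∈ dyadic) {g : H} (hg : g ∈ truncSpan φ p) {c : ℝ} (hc : 0 < c)
    (hgc : l1Norm φ p g ≤ c) :
    Integrable (fun ω => ‖f - fhat (phat ω) ω‖ ^ 2) P ∧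
      ∫ ω, ‖f - fhat (phat ω) ω‖ ^ 2 ∂P ≤ 3 * ‖f - g‖ ^ 2 + 2 * lassoLevel ε p * c +
        2 * sizePen ε p + 4 * ε * c + (8 * ε ^ 2 + 4 * ε * c) * excessConst := by
  set A := 3 * ‖f - g‖ ^ 2 + 2 * lassoLevel ε p * c + 2 * sizePen ε p + 2 * ε * c with hA
  set B := 8 * ε ^ 2 + 4 * ε * c with hB
  have hA0 : 0 ≤ A := by
    have : 0 ≤ lassoLevel ε p := by
      rw [lassoLevel_eq]; have := two_le_noiseLevel p; positivity
    have := sizePen_nonneg ε p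
    positivity
  have hB0 : 0 ≤ B := by positivity
  have hK := excessConst_nonneg
  have hmeas : AEStronglyMeasurable (fun ω => ‖f - fhat (phat ω) ω‖ ^ 2) P :=
    ((aestronglyMeasurable_const.sub hm).norm).pow 2
  -- The excess at the random rank is at most the sum over all dyadic ranks; in `ENNReal` this sum
  -- commutes with the integral, and finiteness then gives integrability.
  have hbound : ∀ᵐ ω ∂P, ENNReal.ofReal (‖f - fhat (phat ω) ω‖ ^ 2) ≤
      ENNReal.ofReal A + ENNReal.ofReal (2 * ε / c * W g ω ^ 2) +
        ENNReal.ofReal B * ∑' J : ℕ, ENNReal.ofReal (excess φ (fun h => W h ω) (2 ^ J)) := by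
    filter_upwards [hlin, hS] with ω h1 h2
    have h3 := IsSelectedLasso.sq_norm_sub_le (w := fun h => W h ω) h1 hφ hε h2 hp hg hc hgc
    obtain ⟨J, hJ⟩ := h2.mem
    have hw : 0 ≤ 2 * ε / c * W g ω ^ 2 := by positivity
    refine (ENNReal.ofReal_le_ofReal h3).trans ?_
    rw [ENNReal.ofReal_add (by positivity) (mul_nonneg hB0 (excess_nonneg _ _ _)),
      ENNReal.ofReal_add hA0 hw, ENNReal.ofReal_mul hB0, hJ]
    gcongr
    exact ENNReal.le_tsum (f := fun J : ℕ => ENNReal.ofReal (excess φ (fun h => W h ω) (2 ^ J))) J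
  have hWsq : ∫⁻ ω, ENNReal.ofReal (2 * ε / c * W g ω ^ 2) ∂P ≤ ENNReal.ofReal (2 * ε * c) := by
    rw [← ofReal_integral_eq_lintegral_ofReal ((hW.integrable_sq g).const_mul _)
      (Filter.Eventually.of_forall fun ω => by positivity), integral_const_mul, hW.integral_sq]
    refine ENNReal.ofReal_le_ofReal ?_
    have hgn : ‖g‖ ≤ c := (norm_le_l1Norm hφ hg).trans hgc
    have : ‖g‖ ^ 2 ≤ c ^ 2 := by gcongr
    calc 2 * ε / c * ‖g‖ ^ 2 ≤ 2 * ε / c * c ^ 2 := by gcongr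
      _ = _ := by field_simp
  have hexm : ∀ J : ℕ, AEMeasurable
      (fun ω => ENNReal.ofReal (excess φ (fun h => W h ω) (2 ^ J))) P := fun J =>
    (hW.integrable_excess φ _).aemeasurable.ennreal_ofReal
  have hl : ∫⁻ ω, ENNReal.ofReal (‖f - fhat (phat ω) ω‖ ^ 2) ∂P ≤
      ENNReal.ofReal (A + 2 * ε * c + B * excessConst) := by
    refine (lintegral_mono_ae hbound).trans ?_
    have hsplit : ENNReal.ofReal (A + 2 * ε * c + B * excessConst) = ENNReal.ofReal A +
        ENNReal.ofReal (2 * ε * c) + ENNReal.ofReal B * ENNReal.ofReal excessConst := by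
      rw [ENNReal.ofReal_add (by positivity) (by positivity),
        ENNReal.ofReal_add hA0 (by positivity), ENNReal.ofReal_mul hB0]
    rw [hsplit, lintegral_add_right' _ ((AEMeasurable.tsum hexm).const_mul _),
      lintegral_add_left measurable_const,
      lintegral_const_mul'' _ (AEMeasurable.tsum hexm), lintegral_tsum hexm,
      lintegral_const, measure_univ, mul_one]
    gcongr
    exact hW.tsum_lintegral_excess_le hφ
  have hnn : 0 ≤ᵐ[P] fun ω => ‖f - fhat (phat ω) ω‖ ^ 2 :=
    Filter.Eventually.of_forall fun ω => sq_nonneg _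
  have hint : Integrable (fun ω => ‖f - fhat (phat ω) ω‖ ^ 2) P :=
    ⟨hmeas, (hasFiniteIntegral_iff_ofReal hnn).2 (hl.trans_lt ENNReal.ofReal_lt_top)⟩
  refine ⟨hint, ?_⟩
  rw [← ofReal_integral_eq_lintegral_ofReal hint hnn,
    ENNReal.ofReal_le_ofReal_iff (by positivity)] at hl
  exact hl.trans_eq (by rw [hA]; ring)

end Oracle

/-! ### Approximation over the interpolation class and the choice of rank. -/

section Rate

variable {H : Type*} [NormedAddCommGroup H] [InnerProductSpace ℝ H] {φ : ℕ → H}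

/-- Makes the infimum in `bqr` range over a nonempty set, so near-minimizers exist. -/
theorem zero_mem_l1rSpace (φ : ℕ → H) (r : ℝ) : (0 : H) ∈ l1rSpace φ r := by
  refine ⟨1, one_pos, fun p _ => ⟨0, Submodule.zero_mem _, ?_, by simp; positivity⟩⟩
  have h0 : BddBelow {x : ℝ | ∃ θ : Fin p → ℝ, (0 : H) = ∑ j : Fin p, θ j • φ j ∧
      x = ∑ j : Fin p, |θ j|} := by
    refine ⟨0, ?_⟩
    rintro _ ⟨θ, -, rfl⟩
    exact Finset.sum_nonneg fun _ _ => abs_nonneg _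
  exact (csInf_le h0 ⟨0, by simp, by simp⟩).trans zero_le_one

/-- Approximation of an element of `bqr φ q r R` by a finite combination: a bound on the
interpolation functional yields, for every `p`, an element of `truncSpan φ p`. -/
theorem exists_approximation_of_mem_bqr {q r R δ : ℝ} {f : H} (hf : f ∈ bqr φ q r R) (hR : 0 < R)
    (hδ : 0 < δ) {p : ℕ} (hp : 1 ≤ p) :
    ∃ g ∈ truncSpan φ p, l1Norm φ p g ≤ 3 * (R * δ ^ (2 * (1 / q - 1 / 2))) / δ ∧
      ‖f - g‖ ≤ 2 * (R * δ ^ (2 * (1 / q - 1 / 2))) +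
        3 * (R * δ ^ (2 * (1 / q - 1 / 2))) / δ * (p : ℝ) ^ (-r) := by
  set b := R * δ ^ (2 * (1 / q - 1 / 2))
  have hb : 0 < b := by positivity
  have h1 : sInf ((fun h : H => ‖f - h‖ + δ * l1rNorm φ r h) '' l1rSpace φ r) < 2 * b :=
    (hf δ hδ).trans_lt (by linarith)
  obtain ⟨_, ⟨h, hh, rfl⟩, h2⟩ :=
    exists_lt_of_csInf_lt (Set.Nonempty.image _ ⟨0, zero_mem_l1rSpace φ r⟩) h1
  have hn : 0 ≤ l1rNorm φ r h := Real.sInf_nonneg fun _ hC => hC.1.le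
  -- `l1rNorm` is again an infimum that may not be attained: the slack `b / δ` turns 2 into 3.
  obtain ⟨C, ⟨hC0, hC⟩, hC2⟩ := exists_lt_of_csInf_lt hh
    (show sInf (l1rConstants φ r h) < l1rNorm φ r h + b / δ by
      unfold l1rNorm; linarith [div_pos hb hδ])
  have hC3 : C ≤ 3 * b / δ := by
    have h3 : l1rNorm φ r h ≤ 2 * b / δ := by
      rw [le_div_iff₀ hδ]
      nlinarith [norm_nonneg (f - h)]
    have h4 : 3 * b / δ = 2 * b / δ + b / δ := by ring
    linarith
  obtain ⟨g, hg, hg1, hg2⟩ := hC p hp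
  refine ⟨g, hg, hg1.trans hC3, ?_⟩
  have h5 : ‖f - h‖ ≤ 2 * b := by
    have := mul_nonneg hδ.le hn
    simp only at h2
    linarith
  have h6 : C * (p : ℝ) ^ (-r) ≤ 3 * b / δ * (p : ℝ) ^ (-r) := by gcongr
  calc ‖f - g‖ = ‖(f - h) + (h - g)‖ := by rw [sub_add_sub_cancel]
    _ ≤ ‖f - h‖ + ‖h - g‖ := norm_add_le _ _
    _ ≤ _ := by linarith

theorem exists_dyadic_mem_Icc {x : ℝ} (hx : 1 ≤ x) :
    ∃ p ∈ dyadic, x ≤ (p : ℝ) ∧ (p : ℝ) ≤ 2 * x := by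
  obtain ⟨n, h1, h2⟩ := exists_nat_pow_near hx one_lt_two
  refine ⟨2 ^ (n + 1), ⟨_, rfl⟩, ?_, ?_⟩
  · push_cast; exact h2.le
  · push_cast; rw [pow_succ]; linarith

theorem lassoLevel_le {ε κ l : ℝ} (hε : 0 < ε) (hκ : 1 ≤ κ) (hl : 1 ≤ l) {p : ℕ}
    (hp : Real.log p ≤ κ * l) : lassoLevel ε p ≤ 4 * (κ + 1) * (ε * Real.sqrt l) := by
  have hs1 : 1 ≤ Real.sqrt l := Real.one_le_sqrt.2 hl
  have hsqrt : Real.sqrt (Real.log p) ≤ κ * Real.sqrt l := by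
    apply Real.sqrt_le_iff.2 ⟨by positivity, hp.trans ?_⟩
    rw [mul_pow, Real.sq_sqrt (by linarith)]
    have : κ ≤ κ ^ 2 := by nlinarith
    gcongr
  unfold lassoLevel
  have : Real.sqrt (Real.log p) + 1 ≤ (κ + 1) * Real.sqrt l := by linarith
  calc 4 * ε * (Real.sqrt (Real.log p) + 1) ≤ 4 * ε * ((κ + 1) * Real.sqrt l) := by gcongr
    _ = _ := by ring

theorem sizePen_le (ε : ℝ) {κ l : ℝ} (hl : 0 ≤ l) {p : ℕ} (hp : Real.log p ≤ κ * l) :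
    sizePen ε p ≤ 5 * κ * (ε * Real.sqrt l) ^ 2 := by
  unfold sizePen
  calc 5 * ε ^ 2 * Real.log p ≤ 5 * ε ^ 2 * (κ * l) := by gcongr
    _ = _ := by rw [mul_pow, Real.sq_sqrt hl]; ring

/-- The constant of the rate. -/
def rateConst (q r : ℝ) : ℝ :=
  111 + 34 * (1 + |q / (2 * r)|) + 20 * excessConst

theorem rateConst_pos (q r : ℝ) : 0 < rateConst q r := by
  have := excessConst_nonneg
  unfold rateConst; positivity

/-- The oracle bound evaluated at the best rank and the best approximation over `bqr φ q r R`. -/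
theorem exists_oracle_le_rate {q r R ε : ℝ} {f : H} (hq : 1 < q) (hq2 : q < 2) (hr : 0 < r)
    (hε : 0 < ε) (hR : 0 < R) (hX : Real.exp 1 ≤ R / ε) (hf : f ∈ bqr φ q r R) :
    ∃ p ∈ dyadic, ∃ g ∈ truncSpan φ p, ∃ c > 0, l1Norm φ p g ≤ c ∧
      3 * ‖f - g‖ ^ 2 + 2 * lassoLevel ε p * c + 2 * sizePen ε p + 4 * ε * c +
        (8 * ε ^ 2 + 4 * ε * c) * excessConst ≤
      rateConst q r * R ^ q * (ε * Real.sqrt (Real.log (R / ε))) ^ (2 - q) := by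
  set X := R / ε with hXdef
  have hX0 : 0 < X := by positivity
  have hX1 : 1 ≤ X := (Real.one_le_exp zero_le_one).trans hX
  set l := Real.log X with hl
  have hl1 : 1 ≤ l := by rwa [hl, Real.le_log_iff_exp_le hX0]
  have hlX : l ≤ X := (Real.log_le_sub_one_of_pos hX0).trans (by linarith)
  set s := Real.sqrt l with hs
  have hs1 : 1 ≤ s := by rw [hs]; exact Real.one_le_sqrt.2 hl1
  have hs2 : s ^ 2 = l := Real.sq_sqrt (by linarith)
  set L := ε * s with hL
  have hL0 : 0 < L := by positivity
  have hεL : ε ≤ L := le_mul_of_one_le_right hε.le hs1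
  set a := L / R with ha
  have ha0 : 0 < a := by positivity
  have haX : a = s / X := by rw [ha, hL, hXdef]; field_simp
  have ha1 : a ≤ 1 := by
    rw [haX, div_le_one hX0]; nlinarith
  have haX' : X⁻¹ ≤ a := by
    rw [haX, inv_eq_one_div]; gcongr
  have hLa : L = R * a := by rw [ha]; field_simp
  -- Solves `b² = L b / δ` for `b = R δ ^ (2 / q - 1)`, i.e. `R δ ^ (2 / q) = L`; both sides then
  -- equal the target rate `T`.
  set δ := a ^ (q / 2) with hδ
  have hδ0 : 0 < δ := by positivity
  set b := R * δ ^ (2 * (1 / q - 1 / 2)) with hb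
  have hb0 : 0 < b := by positivity
  have hb' : b = R * a ^ (1 - q / 2) := by
    rw [hb, hδ, ← Real.rpow_mul ha0.le]
    congr 2
    field_simp
  set T := R ^ q * L ^ (2 - q) with hT
  have hT' : T = R ^ 2 * a ^ (2 - q) := by
    rw [hT, hLa, Real.mul_rpow hR.le ha0.le, ← mul_assoc, ← Real.rpow_add hR]
    congr 1
    rw [← Real.rpow_natCast]
    congr 1
    push_cast; ring
  have hbT : b ^ 2 = T := by
    rw [hb', hT', mul_pow, ← Real.rpow_natCast (a ^ _), ← Real.rpow_mul ha0.le]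
    congr 2
    push_cast; ring
  have hcL : 3 * b / δ * L = 3 * T := by
    have : b * L = T * δ := by
      rw [hb', hT', hLa, hδ]
      have e1 : a ^ (1 - q / 2) * a = a ^ (2 - q / 2) := by
        rw [← Real.rpow_add_one ha0.ne']; congr 1; ring
      have e2 : a ^ (2 - q) * a ^ (q / 2) = a ^ (2 - q / 2) := by
        rw [← Real.rpow_add ha0]; congr 1; ring
      linear_combination R ^ 2 * e1 - R ^ 2 * e2
    rw [div_mul_eq_mul_div, div_eq_iff hδ0.ne']
    linear_combination 3 * this
  have hLT : L ^ 2 ≤ T := by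
    rw [hT', hLa, mul_pow]
    have : a ^ 2 ≤ a ^ (2 - q) := by
      rw [← Real.rpow_natCast]
      exact Real.rpow_le_rpow_of_exponent_ge ha0 ha1 (by push_cast; linarith)
    gcongr
  have hfin : rateConst q r * R ^ q * L ^ (2 - q) =
      (111 + 34 * (1 + |q / (2 * r)|) + 20 * excessConst) * T := by
    rw [hT, rateConst]; ring
  rw [hfin]
  -- With `p ≥ X ^ (q / (2 r))`, `p ^ (-r) ≤ X ^ (-q / 2) ≤ δ`, while `ln p` stays of order `ln X`.
  obtain ⟨p, hp, hp1, hp2⟩ := exists_dyadic_mem_Icc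
    (Real.one_le_rpow hX1 (show 0 ≤ q / (2 * r) by positivity))
  have hp1' := one_le_of_mem_dyadic hp
  have hp0 : (0 : ℝ) < p := by exact_mod_cast hp1'
  obtain ⟨g, hg, hg1, hg2⟩ := exists_approximation_of_mem_bqr hf hR hδ0 hp1'
  refine ⟨p, hp, g, hg, 3 * b / δ, by positivity, hg1, ?_⟩
  rw [← hb] at hg1 hg2
  have hpδ : (p : ℝ) ^ (-r) ≤ δ := by
    calc (p : ℝ) ^ (-r) ≤ (X ^ (q / (2 * r))) ^ (-r) :=
          Real.rpow_le_rpow_of_nonpos (by positivity) hp1 (by linarith)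
      _ = X⁻¹ ^ (q / 2) := by
          rw [← Real.rpow_mul hX0.le, Real.inv_rpow hX0.le, ← Real.rpow_neg hX0.le]
          congr 1
          field_simp
      _ ≤ δ := Real.rpow_le_rpow (by positivity) haX' (by positivity)
  clear_value b δ T a
  have hfg : ‖f - g‖ ≤ 5 * b := by
    have : 3 * b / δ * (p : ℝ) ^ (-r) ≤ 3 * b / δ * δ := by gcongr
    rw [div_mul_cancel₀ _ hδ0.ne'] at this
    linarith
  have hfg2 : ‖f - g‖ ^ 2 ≤ 25 * T := by
    rw [← hbT]; nlinarith [norm_nonneg (f - g)]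
  obtain ⟨κ, hκ⟩ : ∃ κ, κ = 1 + |q / (2 * r)| := ⟨_, rfl⟩
  rw [← hκ]
  have hκ1 : 1 ≤ κ := by rw [hκ]; linarith [abs_nonneg (q / (2 * r))]
  have hlog : Real.log p ≤ κ * l := by
    have h1 := Real.log_le_log hp0 hp2
    rw [Real.log_mul two_ne_zero (by positivity), Real.log_rpow hX0] at h1
    have h2 : Real.log 2 ≤ 1 := (Real.log_le_sub_one_of_pos two_pos).trans (by norm_num)
    have h3 : q / (2 * r) * l ≤ |q / (2 * r)| * l :=
      mul_le_mul_of_nonneg_right (le_abs_self _) (by linarith)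
    rw [hκ]; linarith
  have hlam : lassoLevel ε p * (3 * b / δ) ≤ 12 * (κ + 1) * T := by
    have h1 : lassoLevel ε p ≤ 4 * (κ + 1) * L := lassoLevel_le hε hκ1 hl1 hlog
    calc lassoLevel ε p * (3 * b / δ) ≤ 4 * (κ + 1) * L * (3 * b / δ) := by gcongr
      _ = 4 * (κ + 1) * (3 * b / δ * L) := by ring
      _ = _ := by rw [hcL]; ring
  have hpen : sizePen ε p ≤ 5 * κ * T :=
    (sizePen_le ε (by linarith) hlog).trans (mul_le_mul_of_nonneg_left hLT (by linarith))
  have hεc : ε * (3 * b / δ) ≤ 3 * T := by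
    rw [← hcL, mul_comm]; gcongr
  have hε2 : ε ^ 2 ≤ T := (by gcongr : ε ^ 2 ≤ L ^ 2).trans hLT
  have hK : (8 * ε ^ 2 + 4 * ε * (3 * b / δ)) * excessConst ≤ 20 * T * excessConst :=
    mul_le_mul_of_nonneg_right (by linarith) excessConst_nonneg
  -- The constants are `111 = 3·25 + 24 + 12`, `34 = 24 + 10` (multiplying `κ`) and `20 = 8 + 12`.
  linarith

end Rate

end SelectedLasso

end

theorem proposition5p7 :
    ∃ C : ℝ → ℝ → ℝ, (∀ q r : ℝ, 0 < C q r) ∧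
      ∀ (H : Type*) [NormedAddCommGroup H] [InnerProductSpace ℝ H] [CompleteSpace H]
        [TopologicalSpace.SeparableSpace H]
        (Ω : Type*) [MeasurableSpace Ω] (P : Measure Ω) [IsProbabilityMeasure P]
        (W : H → Ω → ℝ) (φ : ℕ → H) (f : H) (ε : ℝ)
        (fhat : ℕ → Ω → H) (phat : Ω → ℕ),
        SelectedLasso.IsIsonormal W P →
        SelectedLasso.HasLinearPaths φ W P →
        (∀ j : ℕ, ‖φ j‖ ≤ 1) →
        0 < ε →
        (∀ᵐ ω ∂P, SelectedLasso.IsSelectedLasso φ (SelectedLasso.observation f ε W ω) ε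
          (fun p => fhat p ω) (phat ω)) →
        AEStronglyMeasurable (fun ω => fhat (phat ω) ω) P →
        ∀ q r R : ℝ, 1 < q → q < 2 → 0 < r → 0 < R →
          max (Real.exp 1) (q / (4 * r)) ≤ R / ε →
          f ∈ SelectedLasso.bqr φ q r R →
          Integrable (fun ω => ‖f - fhat (phat ω) ω‖ ^ 2) P ∧
            ∫ ω, ‖f - fhat (phat ω) ω‖ ^ 2 ∂P ≤
              C q r * R ^ q * (ε * Real.sqrt (Real.log (R / ε))) ^ (2 - q) := by
  refine ⟨SelectedLasso.rateConst, SelectedLasso.rateConst_pos, ?_⟩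
  intro H _ _ _ _ Ω _ P _ W φ f ε fhat phat hW hlin hφ hε hS hm q r R hq hq2 hr hR hX hf
  obtain ⟨p, hp, g, hg, c, hc, hgc, hle⟩ := SelectedLasso.exists_oracle_le_rate hq hq2 hr hε hR
    ((le_max_left _ _).trans hX) hf
  have h := SelectedLasso.integrable_sq_norm_sub_and_integral_le hW hlin hφ hε hS hm hp hg hc hgc
  exact ⟨h.1, h.2.trans hle⟩
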